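/- Let $T:(0,1]\to[0,1)$ be the Engel continued fraction map $T x=\frac{1}{\lfloor 1/x\rfloor}\left(\frac1x-\left\lfloor \frac1x\right\rfloor\right)$, and for $x\in(0,1]$ let $b_1(x)=\lfloor 1/x\rfloor$ and $b_{n+1}(x)=b_1(T^n x)$, $n\ge 1$, be the partial quotients of its Engel continued fraction expansion (for every $n$ they are defined for all irrational $x$, hence Lebesgue-almost everywhere; the values elsewhere are immaterial). Let $\mathbf P$ be Lebesgue measure on the Borel sets of $(0,1]$. Let $(a_n)_{n\ge1}$ be a sequence of positive real numbers with $$a_n\to\infty,\qquad \frac{a_n}{\sqrt{n\log n}}\to\infty,\qquad \frac{a_n}{n}\to 0 \qquad (n\to\infty).$$ Then $\left\{\frac{\log b_n-n}{a_n}:n\ge1\right\}$ satisfies a moderate deviation principle with speed $a_n^2/n$ (which tends to infinity) and good rate function $J(x)=x^2/2$, $x\in\mathbb R$. That is, $J$ is lower semicontinuous with compact level sets $\{J\le c\}$, $0\le c<\infty$, and for every Borel set $\Gamma\subseteq\mathbb R$, $$-\inf_{x\in\Gamma^\circ}\frac{x^2}{2}\le\liminf_{n\to\infty}\frac{n}{a_n^2}\log\mathbf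 P\left(\frac{\log b_n-n}{a_n}\in\Gamma\right)\le\limsup_{n\to\infty}\frac{n}{a_n^2}\log\mathbf P\left(\frac{\log b_n-n}{a_n}\in\Gamma\right)\le-\inf_{x\in\overline\Gamma}\frac{x^2}{2},$$ where $\Gamma^\circ$ and $\overline\Gamma$ are the interior and the closure of $\Gamma$, $\log 0=-\infty$ and $\inf\emptyset=+\infty$. -/

import Mathlib

open MeasureTheory Filter Topology
open scoped NNReal ENNReal

/-- The Engel continued fraction map `T x = (1 / ⌊1/x⌋) * (1/x - ⌊1/x⌋)`, for `x ∈ (0,1]`.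
It takes values in `[0,1)`; since `1 / 0 = 0`, it fixes `0`, so an orbit that has reached `0`
(this happens exactly for rational starting points) stays there. -/
noncomputable def engelMap (x : ℝ) : ℝ :=
  1 / (⌊1 / x⌋₊ : ℝ) * (1 / x - (⌊1 / x⌋₊ : ℝ))

/-- The `n`-th partial quotient, `n ≥ 1`, of the Engel continued fraction expansion:
`b_1 x = ⌊1/x⌋` and `b_{n+1} x = b_1 (T^n x)`. The value at `n = 0` is never used.
Where the expansion has already terminated (on a set of rational points) the value is `0`. -/
noncomputable def engelPartialQuotient (n : ℕ) (x : ℝ) : ℕ :=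
  ⌊1 / engelMap^[n - 1] x⌋₊

/-- A good rate function on `ℝ`: lower semicontinuous with compact (finite) level sets. -/
def IsGoodRateFunction (I : ℝ → ℝ≥0∞) : Prop :=
  LowerSemicontinuous I ∧ ∀ c : ℝ≥0, IsCompact {x | I x ≤ c}

/-- The sequence `(X n)`, `n ≥ 1`, of real random variables satisfies under `P` the deviation
principle (called large or moderate according to the normalization of `X n`) with speed `v n → ∞`
and good rate function `I`. Logarithms and infima are extended-real valued, with `log 0 = -∞`
and `inf ∅ = +∞`. -/
def SatisfiesDeviationPrinciple {Ω : Type*} [MeasurableSpace Ω] (P : Measure Ω)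
    (X : ℕ → Ω → ℝ) (v : ℕ → ℝ) (I : ℝ → ℝ≥0∞) : Prop :=
  (∀ n, 1 ≤ n → Measurable (X n)) ∧
  (∀ n, 1 ≤ n → 0 < v n) ∧ Tendsto v atTop atTop ∧
  IsGoodRateFunction I ∧
  ∀ Γ : Set ℝ, MeasurableSet Γ →
    -(⨅ x ∈ interior Γ, (I x : EReal)) ≤
        liminf (fun n => ((1 / v n : ℝ) : EReal) * ENNReal.log (P {ω | X n ω ∈ Γ})) atTop ∧
    liminf (fun n => ((1 / v n : ℝ) : EReal) * ENNReal.log (P {ω | X n ω ∈ Γ})) atTop ≤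
        limsup (fun n => ((1 / v n : ℝ) : EReal) * ENNReal.log (P {ω | X n ω ∈ Γ})) atTop ∧
    limsup (fun n => ((1 / v n : ℝ) : EReal) * ENNReal.log (P {ω | X n ω ∈ Γ})) atTop ≤
        -(⨅ x ∈ closure Γ, (I x : EReal))

/-! Given its history, `T^n x` has density `(β + c) / (1 + c x)^2` on `(0, 1/β]`, where `β` is the
last partial quotient and `c ∈ [0, 1]`. Passing to the next quotient `k ≥ β` keeps this family and
sends `(β, c)` to `(k, k / (k + c))` with probability `engelWeight β c k`
(`lintegral_comp_engelMap_cylinder`). Lebesgue measure is the case `β = 1`, `c = 0`.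

For fixed `c`, a function with `w (k + 1) = w k * (1 + l / (k + c))` satisfies `∑ weight * w k = (1
- l)⁻¹ * w β` by telescoping, provided `w k = o(k)`. Since `c` changes from step to step but stays
in `[0, 1]`, exact eigenfunctions are replaced by sub- and super-eigenfunctions valid for every such
`c`, all comparable with `k ^ l`. Hence `E[b_n ^ l]` equals `(1 - l)^(-n)` up to a factor 16, for
`|l| ≤ 1/2` (`lintegral_engelPartialQuotient_bounds`).

Taking `l = θ a_n / n → 0`, the expansion `-log (1 - l) = l + l²/2 + O(|l|³)` makes the scaled
logarithmic moment generating function tend to `θ²/2`; the constant 16 vanishes because the speed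
tends to infinity. A Gärtner–Ellis argument (Chernoff bound, exponential tilting) finishes. -/

/-! ### Conditional densities and the first-digit cylinders -/

theorem measurable_engelMap : Measurable engelMap := by
  unfold engelMap
  fun_prop

theorem measurable_engelPartialQuotient (n : ℕ) : Measurable (engelPartialQuotient n) := by
  unfold engelPartialQuotient
  have h := measurable_engelMap.iterate (n - 1)
  exact Nat.measurable_floor.comp (measurable_const.div h)

/-- The density on `(0, 1/β]` of the law of `T^n x` given its history, up to parameters. -/
noncomputable def engelDensity (β c x : ℝ) : ℝ := (β + c) / (1 + c * x) ^ 2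

theorem measurable_engelDensity (β c : ℝ) : Measurable (engelDensity β c) := by
  unfold engelDensity
  fun_prop

/-- The probability that the next partial quotient is `k`. -/
noncomputable def engelWeight (β c k : ℝ) : ℝ := (β + c) / ((k + c) * (k + 1 + c))

theorem floor_one_div_eq {k : ℕ} (hk : 1 ≤ k) {x : ℝ}
    (hx : x ∈ Set.Ioc (1 / ((k : ℝ) + 1)) (1 / (k : ℝ))) : ⌊1 / x⌋₊ = k := by
  have hk' : (0 : ℝ) < k := by exact_mod_cast hk
  have hx0 : 0 < x := lt_trans (by positivity) hx.1
  rw [Nat.floor_eq_iff (by positivity)]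
  constructor
  · exact (le_one_div hk' hx0).2 hx.2
  · exact (one_div_lt hx0 (by positivity)).2 hx.1

theorem lintegral_engelDensity {β : ℕ} (hβ : 1 ≤ β) {c : ℝ} (hc : 0 ≤ c) :
    ∫⁻ x in Set.Ioc (0 : ℝ) (1 / (β : ℝ)), ENNReal.ofReal (engelDensity β c x) = 1 := by
  have hβ' : (0 : ℝ) < β := by exact_mod_cast hβ
  have hβ0 : (0 : ℝ) ≤ 1 / (β : ℝ) := by positivity
  have hpos : ∀ x ∈ Set.Icc (0 : ℝ) (1 / (β : ℝ)), 0 < 1 + c * x := fun x hx => by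
    have := mul_nonneg hc hx.1
    linarith
  have hcont : ContinuousOn (engelDensity β c) (Set.Icc (0 : ℝ) (1 / (β : ℝ))) := by
    unfold engelDensity
    refine ContinuousOn.div (by fun_prop) (by fun_prop) fun x hx => ?_
    have := hpos x hx
    positivity
  have hint : IntervalIntegrable (engelDensity β c) volume 0 (1 / (β : ℝ)) := by
    apply ContinuousOn.intervalIntegrable
    rwa [Set.uIcc_of_le hβ0]
  have hI : ∫ x in (0 : ℝ)..(1 / (β : ℝ)), engelDensity β c x = 1 := by
    rw [intervalIntegral.integral_eq_sub_of_hasDerivAt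
      (f := fun x => (β + c) * x / (1 + c * x)) (fun x hx => ?_) hint]
    · field_simp
      simp
    · rw [Set.uIcc_of_le hβ0] at hx
      have h0 := (hpos x hx).ne'
      have h1 : HasDerivAt (fun x : ℝ => ((β : ℝ) + c) * x) (β + c) x := by
        simpa using (hasDerivAt_id x).const_mul ((β : ℝ) + c)
      have h2 : HasDerivAt (fun x : ℝ => 1 + c * x) c x := by
        simpa using ((hasDerivAt_id x).const_mul c).const_add 1
      exact (h1.div h2 h0).congr_deriv (by rw [engelDensity]; ring)
  rw [← ofReal_integral_eq_lintegral_ofReal, ← intervalIntegral.integral_of_le hβ0, hI,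
    ENNReal.ofReal_one]
  · exact (intervalIntegrable_iff_integrableOn_Ioc_of_le hβ0).1 hint
  · refine Eventually.of_forall fun x => ?_
    unfold engelDensity
    positivity

/-- The inverse branch of the map on the cylinder `b_1 = k`. -/
theorem engelMap_one_div {k : ℕ} (hk : 1 ≤ k) {t : ℝ}
    (ht : t ∈ Set.Ico (0 : ℝ) (1 / (k : ℝ))) :
    1 / (k * (1 + t)) ∈ Set.Ioc (1 / ((k : ℝ) + 1)) (1 / (k : ℝ)) ∧
      engelMap (1 / (k * (1 + t))) = t := by
  have hk' : (0 : ℝ) < k := by exact_mod_cast hk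
  have ht1 : 0 < 1 + t := by linarith [ht.1]
  have hkt : (k : ℝ) * t < 1 := by
    have := (lt_div_iff₀ hk').1 ht.2
    linarith
  have hmem : 1 / (k * (1 + t)) ∈ Set.Ioc (1 / ((k : ℝ) + 1)) (1 / (k : ℝ)) := by
    constructor
    · apply one_div_lt_one_div_of_lt (by positivity)
      linarith
    · apply one_div_le_one_div_of_le hk'
      nlinarith [ht.1]
  refine ⟨hmem, ?_⟩
  unfold engelMap
  rw [floor_one_div_eq hk hmem]
  field_simp
  ring

theorem image_one_div {k : ℕ} (hk : 1 ≤ k) :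
    (fun t : ℝ => 1 / (k * (1 + t))) '' Set.Ico (0 : ℝ) (1 / (k : ℝ)) =
      Set.Ioc (1 / ((k : ℝ) + 1)) (1 / (k : ℝ)) := by
  have hk' : (0 : ℝ) < k := by exact_mod_cast hk
  apply Set.Subset.antisymm
  · rintro _ ⟨t, ht, rfl⟩
    exact (engelMap_one_div hk ht).1
  · intro x hx
    have hx0 : 0 < x := lt_trans (by positivity) hx.1
    refine ⟨1 / (k * x) - 1, ⟨?_, ?_⟩, ?_⟩
    · rw [sub_nonneg, one_le_div (by positivity)]
      have := (le_div_iff₀ hk').1 hx.2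
      linarith
    · have := (div_lt_iff₀ (by positivity)).1 hx.1
      rw [sub_lt_iff_lt_add, div_lt_iff₀ (by positivity)]
      field_simp
      linarith
    · simp only
      field_simp
      ring

/-- The Markov property: substituting `x = 1 / (k (1 + t))`, with Jacobian `1 / (k (1 + t)^2)`,
reproduces the same family of densities with new parameters, and the weight is the mass of the
cylinder. -/
theorem lintegral_comp_engelMap_cylinder {k : ℕ} (hk : 1 ≤ k) {β c : ℝ} (hβ : 0 ≤ β)
    (hc : 0 ≤ c) (h : ℝ → ℝ≥0∞) (hh : Measurable h) :
    ∫⁻ x in Set.Ioc (1 / ((k : ℝ) + 1)) (1 / (k : ℝ)),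
        h (engelMap x) * ENNReal.ofReal (engelDensity β c x) =
      ENNReal.ofReal (engelWeight β c k) *
        ∫⁻ t in Set.Ioc (0 : ℝ) (1 / (k : ℝ)),
          h t * ENNReal.ofReal (engelDensity k (k / (k + c)) t) := by
  have hk' : (0 : ℝ) < k := by exact_mod_cast hk
  rw [← image_one_div hk, lintegral_image_eq_lintegral_abs_deriv_mul measurableSet_Ico
    (f' := fun t => -(1 / (k * (1 + t) ^ 2))) (fun t ht => ?_) ?_,
    ← lintegral_const_mul, setLIntegral_congr (Ico_ae_eq_Ioc (μ := volume)).symm]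
  · refine setLIntegral_congr_fun measurableSet_Ico fun t ht => ?_
    have ht1 : 0 < 1 + t := by linarith [ht.1]
    rw [(engelMap_one_div hk ht).2, mul_left_comm, mul_left_comm _ (h t),
      ← ENNReal.ofReal_mul (by positivity), ← ENNReal.ofReal_mul (by unfold engelWeight; positivity)]
    congr 2
    rw [abs_neg, abs_of_nonneg (by positivity)]
    unfold engelDensity engelWeight
    have e1 : 1 + c * (1 / (k * (1 + t))) = (k * (1 + t) + c) / (k * (1 + t)) := by
      field_simp
    have e2 : 1 + k / (k + c) * t = (k * (1 + t) + c) / (k + c) := by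
      field_simp
      ring
    rw [e1, e2]
    have : (k : ℝ) * (1 + t) + c ≠ 0 := by positivity
    field_simp
    ring
  · exact (hh.mul (measurable_engelDensity _ _).ennreal_ofReal)
  · intro s hs t ht hst
    have hs1 : 0 < 1 + s := by linarith [hs.1]
    have ht1 : 0 < 1 + t := by linarith [ht.1]
    simp only at hst
    have := (engelMap_one_div hk hs).2
    rw [hst, (engelMap_one_div hk ht).2] at this
    exact this.symm
  · have ht1 : 0 < 1 + t := by linarith [ht.1]
    apply HasDerivAt.hasDerivWithinAt
    have h1 : HasDerivAt (fun t : ℝ => (k : ℝ) * (1 + t)) k t := by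
      simpa using ((hasDerivAt_id t).const_add 1).const_mul (k : ℝ)
    simp only [one_div]
    exact (h1.inv (by positivity)).congr_deriv (by field_simp)

theorem iUnion_cylinder {β : ℕ} (hβ : 1 ≤ β) :
    ⋃ i : ℕ, Set.Ioc (1 / (((β + i : ℕ) : ℝ) + 1)) (1 / ((β + i : ℕ) : ℝ)) =
      Set.Ioc (0 : ℝ) (1 / (β : ℝ)) := by
  have hβ' : (0 : ℝ) < β := by exact_mod_cast hβ
  ext x
  simp only [Set.mem_iUnion]
  constructor
  · rintro ⟨i, hi⟩
    refine ⟨lt_trans (by positivity) hi.1, hi.2.trans ?_⟩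
    apply one_div_le_one_div_of_le hβ'
    push_cast
    linarith [(Nat.cast_nonneg i : (0 : ℝ) ≤ i)]
  · intro hx
    have hle : β ≤ ⌊1 / x⌋₊ := Nat.le_floor ((le_one_div hβ' hx.1).2 hx.2)
    refine ⟨⌊1 / x⌋₊ - β, ?_⟩
    rw [Nat.add_sub_cancel' hle]
    have h1 : (0 : ℝ) < ⌊1 / x⌋₊ := by exact_mod_cast hβ.trans hle
    constructor
    · exact (one_div_lt (by positivity) hx.1).2 (Nat.lt_floor_add_one _)
    · exact (le_one_div hx.1 h1).2 (Nat.floor_le (by have := hx.1; positivity))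

theorem pairwise_disjoint_cylinder {β : ℕ} (hβ : 1 ≤ β) :
    Pairwise (Function.onFun Disjoint fun i : ℕ =>
      Set.Ioc (1 / (((β + i : ℕ) : ℝ) + 1)) (1 / ((β + i : ℕ) : ℝ))) := by
  intro i j hij
  refine Set.disjoint_left.2 fun x hi hj => hij ?_
  have h1 := floor_one_div_eq (by omega) hi
  have h2 := floor_one_div_eq (by omega) hj
  omega

/-! ### First-step recursion for expectations -/

/-- The integral of `φ (b_{n+1})` against the density with parameters `β`, `c`. -/
noncomputable def engelExpectation (φ : ℕ → ℝ≥0∞) (n β : ℕ) (c : ℝ) : ℝ≥0∞ :=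
  ∫⁻ x in Set.Ioc (0 : ℝ) (1 / (β : ℝ)),
    φ (engelPartialQuotient (n + 1) x) * ENNReal.ofReal (engelDensity β c x)

theorem lintegral_eq_tsum_cylinder {β : ℕ} (hβ : 1 ≤ β) (F : ℝ → ℝ≥0∞) :
    ∫⁻ x in Set.Ioc (0 : ℝ) (1 / (β : ℝ)), F x =
      ∑' i : ℕ, ∫⁻ x in Set.Ioc (1 / (((β + i : ℕ) : ℝ) + 1)) (1 / ((β + i : ℕ) : ℝ)), F x := by
  rw [← iUnion_cylinder hβ, lintegral_iUnion (fun _ => measurableSet_Ioc)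
    (pairwise_disjoint_cylinder hβ)]

theorem engelExpectation_zero (φ : ℕ → ℝ≥0∞) {β : ℕ} (hβ : 1 ≤ β) {c : ℝ} (hc : 0 ≤ c) :
    engelExpectation φ 0 β c =
      ∑' i : ℕ, ENNReal.ofReal (engelWeight β c (β + i : ℕ)) * φ (β + i) := by
  rw [engelExpectation, lintegral_eq_tsum_cylinder hβ]
  refine tsum_congr fun i => ?_
  have hk : 1 ≤ β + i := by omega
  have h1 := lintegral_comp_engelMap_cylinder hk (Nat.cast_nonneg β) hc (fun _ => φ (β + i))
    measurable_const
  have h2 : ∫⁻ t in Set.Ioc (0 : ℝ) (1 / ((β + i : ℕ) : ℝ)), φ (β + i) *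
      ENNReal.ofReal (engelDensity ((β + i : ℕ) : ℝ) ((β + i : ℕ) / ((β + i : ℕ) + c)) t) =
      φ (β + i) := by
    rw [lintegral_const_mul _ (measurable_engelDensity _ _).ennreal_ofReal,
      lintegral_engelDensity hk (by positivity), mul_one]
  rw [h2] at h1
  rw [← h1]
  refine setLIntegral_congr_fun measurableSet_Ioc fun x hx => ?_
  simp only [engelPartialQuotient, zero_add, Nat.sub_self, Function.iterate_zero, id]
  rw [floor_one_div_eq hk hx]

theorem engelExpectation_succ (φ : ℕ → ℝ≥0∞) (n : ℕ) {β : ℕ} (hβ : 1 ≤ β) {c : ℝ}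
    (hc : 0 ≤ c) :
    engelExpectation φ (n + 1) β c =
      ∑' i : ℕ, ENNReal.ofReal (engelWeight β c (β + i : ℕ)) *
        engelExpectation φ n (β + i) (((β + i : ℕ) : ℝ) / ((β + i : ℕ) + c)) := by
  rw [engelExpectation, lintegral_eq_tsum_cylinder hβ]
  refine tsum_congr fun i => ?_
  have hk : 1 ≤ β + i := by omega
  -- By definition of the iterates, `b_{n+2} x = b_{n+1} (T x)`.
  exact lintegral_comp_engelMap_cylinder hk (Nat.cast_nonneg β) hc
    (fun t => φ (engelPartialQuotient (n + 1) t))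
    ((measurable_of_countable φ).comp (measurable_engelPartialQuotient _))

/-! ### Harmonic products and their power growth -/

/-- The product `∏_{i=1}^{m} (1 + l / i)`, comparable with `(m + 1) ^ l`. -/
noncomputable def harmonicProd (l : ℝ) (m : ℕ) : ℝ := ∏ i ∈ Finset.range m, (1 + l / (i + 1))

theorem harmonicProd_zero (l : ℝ) : harmonicProd l 0 = 1 := by simp [harmonicProd]

theorem harmonicProd_succ (l : ℝ) (m : ℕ) :
    harmonicProd l (m + 1) = harmonicProd l m * (1 + l / (m + 1)) := by
  simp [harmonicProd, Finset.prod_range_succ]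

theorem one_add_div_pos {l : ℝ} (hl : |l| ≤ 1 / 2) (m : ℕ) : 0 < 1 + l / ((m : ℝ) + 1) := by
  have h1 : (1 : ℝ) ≤ m + 1 := by linarith [(Nat.cast_nonneg m : (0 : ℝ) ≤ m)]
  have h2 : -(1 / 2) ≤ l / ((m : ℝ) + 1) := by
    rw [le_div_iff₀ (by linarith)]
    nlinarith [(abs_le.1 hl).1]
  linarith

theorem harmonicProd_pos {l : ℝ} (hl : |l| ≤ 1 / 2) (m : ℕ) : 0 < harmonicProd l m :=
  Finset.prod_pos fun i _ => one_add_div_pos hl i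

/-- Factorwise `(1 + x)(1 - x) ≤ 1`. This turns lower bounds for `-l` into upper bounds for `l`. -/
theorem harmonicProd_mul_neg_le_one {l : ℝ} (hl : |l| ≤ 1 / 2) (m : ℕ) :
    harmonicProd l m * harmonicProd (-l) m ≤ 1 := by
  rw [harmonicProd, harmonicProd, ← Finset.prod_mul_distrib]
  refine Finset.prod_le_one (fun i _ => ?_) fun i _ => ?_
  · exact (mul_pos (one_add_div_pos hl i) (one_add_div_pos (by rwa [abs_neg]) i)).le
  · rw [neg_div]
    nlinarith [sq_nonneg (l / ((i : ℝ) + 1))]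

/-- Bernoulli's inequality for exponents in `[0, 1]`, applied to each ratio `1 + 1 / (m + 1)`. -/
theorem rpow_le_harmonicProd {l : ℝ} (h0 : 0 ≤ l) (h1 : l ≤ 1 / 2) (m : ℕ) :
    ((m : ℝ) + 1) ^ l ≤ harmonicProd l m := by
  induction m with
  | zero => simp [harmonicProd_zero]
  | succ m ih =>
    have hm : (0 : ℝ) < (m : ℝ) + 1 := by positivity
    rw [harmonicProd_succ]
    have e : (((m + 1 : ℕ) : ℝ) + 1) = (m + 1) * (1 + 1 / (m + 1)) := by
      push_cast
      field_simp
    rw [e, Real.mul_rpow hm.le (by positivity)]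
    refine mul_le_mul ih ?_ (by positivity) (by linarith [Real.rpow_pos_of_pos hm l])
    have := rpow_one_add_le_one_add_mul_self (s := 1 / ((m : ℝ) + 1)) (p := l)
      (by have : 0 ≤ 1 / ((m : ℝ) + 1) := by positivity
          linarith) h0 (by linarith)
    rwa [mul_one_div] at this

theorem le_harmonicProd_neg {l : ℝ} (h0 : 0 ≤ l) (h1 : l ≤ 1 / 2) (m : ℕ) :
    1 / 2 * ((m : ℝ) + 1) ^ (-l) ≤ harmonicProd (-l) m := by
  -- The first factor `1 - l ≥ 1/2` supplies the constant; Bernoulli's inequality handles the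
  -- remaining factors, with ratios `1 - 1 / (m + 2)`.
  have key : ∀ m : ℕ, 1 / 2 * ((m : ℝ) + 1) ^ (-l) ≤ harmonicProd (-l) (m + 1) := by
    intro m
    induction m with
    | zero =>
      simp [harmonicProd_succ, harmonicProd_zero]
      linarith
    | succ m ih =>
      have hm : (0 : ℝ) < (m : ℝ) + 1 := by positivity
      rw [harmonicProd_succ]
      have hd : 1 / ((m : ℝ) + 2) ≤ 1 := by
        rw [div_le_one (by linarith)]
        linarith
      have e : ((m : ℝ) + 1) = ((m + 1 : ℕ) + 1) * (1 + -(1 / (m + 2))) := by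
        push_cast
        field_simp
        ring
      have hpos : 0 < 1 + -(1 / ((m : ℝ) + 2)) := by
        have : 1 / ((m : ℝ) + 2) < 1 := by
          rw [div_lt_one (by linarith)]
          linarith
        linarith
      have hb := rpow_one_add_le_one_add_mul_self (s := -(1 / ((m : ℝ) + 2))) (p := l)
        (by linarith) h0 (by linarith)
      have e2 : (((m + 1 : ℕ) : ℝ) + 1) ^ (-l) =
          ((m : ℝ) + 1) ^ (-l) * (1 + -(1 / ((m : ℝ) + 2))) ^ l := by
        rw [e]
        rw [Real.mul_rpow (by positivity) hpos.le, mul_assoc, ← Real.rpow_add hpos]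
        simp
      rw [e2, ← mul_assoc]
      refine mul_le_mul ih ?_ (by positivity) (harmonicProd_pos ?_ _).le
      · refine hb.trans (le_of_eq ?_)
        push_cast
        field_simp
        ring
      · rw [abs_neg, abs_of_nonneg h0]
        exact h1
  cases m with
  | zero => norm_num [harmonicProd_zero]
  | succ m =>
    refine le_trans ?_ (key m)
    have hm : (0 : ℝ) < (m : ℝ) + 1 := by positivity
    have := Real.rpow_le_rpow_of_nonpos hm (show (m : ℝ) + 1 ≤ ((m + 1 : ℕ) : ℝ) + 1 by
      push_cast
      linarith) (show -l ≤ 0 by linarith)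
    linarith

theorem harmonicProd_bounds {l : ℝ} (hl : |l| ≤ 1 / 2) (m : ℕ) :
    1 / 2 * ((m : ℝ) + 1) ^ l ≤ harmonicProd l m ∧
      harmonicProd l m ≤ 2 * ((m : ℝ) + 1) ^ l := by
  have hm : (0 : ℝ) < (m : ℝ) + 1 := by positivity
  have hp := harmonicProd_pos hl m
  have hn := harmonicProd_pos (l := -l) (by rwa [abs_neg]) m
  have hr := Real.rpow_pos_of_pos hm l
  have hmul := harmonicProd_mul_neg_le_one hl m
  have hone : ((m : ℝ) + 1) ^ l * ((m : ℝ) + 1) ^ (-l) = 1 := by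
    rw [← Real.rpow_add hm]
    simp
  have hrn := Real.rpow_pos_of_pos hm (-l)
  rcases le_total 0 l with h0 | h0
  · rw [abs_of_nonneg h0] at hl
    have a1 := rpow_le_harmonicProd h0 hl m
    have a2 := le_harmonicProd_neg h0 hl m
    refine ⟨by linarith, ?_⟩
    have : harmonicProd l m * (1 / 2 * ((m : ℝ) + 1) ^ (-l)) ≤ 1 :=
      (mul_le_mul_of_nonneg_left a2 hp.le).trans hmul
    nlinarith
  · rw [abs_of_nonpos h0] at hl
    have a1 := rpow_le_harmonicProd (l := -l) (by linarith) hl m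
    have a2 := le_harmonicProd_neg (l := -l) (by linarith) hl m
    rw [neg_neg] at a2
    refine ⟨a2, ?_⟩
    have : harmonicProd l m * ((m : ℝ) + 1) ^ (-l) ≤ 1 :=
      (mul_le_mul_of_nonneg_left a1 hp.le).trans hmul
    nlinarith

/-! ### Telescoping for the transition weights -/

/-- After multiplication by `w k`, with `w (k + 1) = w k * (1 + l / (k + c))`, the right side is `g
k - g (k + 1)` for `g k = (β + c) / (k + c) * w k`, and `g β = w β`. -/
theorem one_sub_mul_engelWeight {β c k : ℝ} (l : ℝ) (hc : 0 ≤ c) (hk : 0 < k) :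
    (1 - l) * engelWeight β c k =
      (β + c) / (k + c) - (β + c) / (k + 1 + c) * (1 + l / (k + c)) := by
  unfold engelWeight
  field_simp
  ring

theorem engelWeight_nonneg {β c k : ℝ} (hβ : 0 ≤ β) (hc : 0 ≤ c) (hk : 0 ≤ k) :
    0 ≤ engelWeight β c k := by
  unfold engelWeight
  positivity

theorem sum_engelWeight_mul_le {l : ℝ} (hl : |l| ≤ 1 / 2) {w : ℕ → ℝ} {c : ℝ} (hc : 0 ≤ c)
    (hw : ∀ k, 0 ≤ w k)
    (hstep : ∀ k : ℕ, 1 ≤ k → w (k + 1) ≤ w k * (1 + l / (k + c))) {β : ℕ} (hβ : 1 ≤ β) :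
    ∑' i : ℕ, ENNReal.ofReal (engelWeight β c (β + i : ℕ)) * ENNReal.ofReal (w (β + i)) ≤
      ENNReal.ofReal ((1 - l)⁻¹ * w β) := by
  have hl1 : 0 < 1 - l := by linarith [(abs_le.1 hl).2]
  have hβ' : (0 : ℝ) < β := by exact_mod_cast hβ
  -- Telescoped partial sums; the boundary term is nonnegative and is dropped at the end.
  have key : ∀ N : ℕ, (1 - l) * ∑ i ∈ Finset.range N, engelWeight β c (β + i : ℕ) * w (β + i) ≤
      w β - (β + c) / ((β + N : ℕ) + c) * w (β + N) := by
    intro N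
    induction N with
    | zero =>
      have : ((β : ℝ) + c) / (β + c) = 1 := div_self (by positivity)
      simp [this]
    | succ N ih =>
      rw [Finset.sum_range_succ, mul_add]
      have hk : (0 : ℝ) < (β + N : ℕ) := by exact_mod_cast Nat.lt_of_lt_of_le hβ (by omega)
      have h1 := one_sub_mul_engelWeight (β := β) l hc hk
      have h2 := mul_le_mul_of_nonneg_left (hstep (β + N) (by omega))
        (show 0 ≤ ((β : ℝ) + c) / ((β + N : ℕ) + 1 + c) by positivity)
      have h3 : (1 - l) * (engelWeight β c (β + N : ℕ) * w (β + N)) =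
          ((β + c) / ((β + N : ℕ) + c) -
            (β + c) / ((β + N : ℕ) + 1 + c) * (1 + l / ((β + N : ℕ) + c))) * w (β + N) := by
        rw [← h1]
        ring
      rw [h3, ← add_assoc β N 1, Nat.cast_add (β + N) 1, Nat.cast_one]
      linarith
  refine ENNReal.tsum_le_of_sum_range_le fun N => ?_
  have hterm : ∀ i ∈ Finset.range N, ENNReal.ofReal (engelWeight β c (β + i : ℕ)) *
      ENNReal.ofReal (w (β + i)) = ENNReal.ofReal (engelWeight β c (β + i : ℕ) * w (β + i)) :=
    fun i _ => (ENNReal.ofReal_mul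
      (engelWeight_nonneg hβ'.le hc (Nat.cast_nonneg _))).symm
  rw [Finset.sum_congr rfl hterm, ← ENNReal.ofReal_sum_of_nonneg fun i _ =>
    mul_nonneg (engelWeight_nonneg hβ'.le hc (Nat.cast_nonneg _)) (hw _)]
  apply ENNReal.ofReal_le_ofReal
  rw [inv_mul_eq_div, le_div_iff₀ hl1, mul_comm]
  have h4 : 0 ≤ (β + c) / ((β + N : ℕ) + c) * w (β + N) := mul_nonneg (by positivity) (hw _)
  linarith [key N]

/-- In the lower bound the boundary term cannot be dropped; it vanishes in the limit because `w`
grows at most like `k ^ (1/2)`. -/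
theorem tendsto_tail_mul {w : ℕ → ℝ} {c K : ℝ} (hc : 0 ≤ c) (hw : ∀ k, 0 ≤ w k)
    (hK : ∀ k : ℕ, 1 ≤ k → w k ≤ K * (k : ℝ) ^ (1 / 2 : ℝ)) {β : ℕ} (hβ : 1 ≤ β) :
    Tendsto (fun N : ℕ => (β + c) / ((β + N : ℕ) + c) * w (β + N)) atTop (𝓝 0) := by
  have hβ' : (0 : ℝ) < β := by exact_mod_cast hβ
  have h1 : Tendsto (fun N : ℕ => ((β + N : ℕ) : ℝ)) atTop atTop :=
    tendsto_natCast_atTop_atTop.comp (tendsto_atTop_mono (fun n => Nat.le_add_left n β) tendsto_id)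
  have h2 := ((tendsto_rpow_neg_atTop (show (0 : ℝ) < 1 / 2 by norm_num)).comp h1).const_mul
    (((β : ℝ) + c) * K)
  rw [mul_zero] at h2
  refine squeeze_zero (fun N => mul_nonneg (by positivity) (hw _)) (fun N => ?_) h2
  have hk : (0 : ℝ) < (β + N : ℕ) := by exact_mod_cast Nat.lt_of_lt_of_le hβ (by omega)
  have hwN := hK (β + N) (by omega)
  have hsplit : ((β + N : ℕ) : ℝ) ^ (-(1 / 2) : ℝ) =
      ((β + N : ℕ) : ℝ) ^ (1 / 2 : ℝ) / (β + N : ℕ) := by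
    rw [eq_div_iff hk.ne']
    nth_rw 2 [← Real.rpow_one ((β + N : ℕ) : ℝ)]
    rw [← Real.rpow_add hk]
    norm_num
  have hK0 : 0 ≤ K * ((β + N : ℕ) : ℝ) ^ (1 / 2 : ℝ) := (hw _).trans hwN
  calc (β + c) / ((β + N : ℕ) + c) * w (β + N)
      ≤ (β + c) / (β + N : ℕ) * (K * ((β + N : ℕ) : ℝ) ^ (1 / 2 : ℝ)) := by
        refine mul_le_mul ?_ hwN (hw _) (by positivity)
        exact div_le_div_of_nonneg_left (by positivity) hk (by linarith)
    _ = (β + c) * K * (((β + N : ℕ) : ℝ) ^ (-(1 / 2) : ℝ)) := by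
        rw [hsplit]
        ring

theorem le_sum_engelWeight_mul {l : ℝ} (hl : |l| ≤ 1 / 2) {w : ℕ → ℝ} {c K : ℝ} (hc : 0 ≤ c)
    (hw : ∀ k, 0 ≤ w k) (hK : ∀ k : ℕ, 1 ≤ k → w k ≤ K * (k : ℝ) ^ (1 / 2 : ℝ))
    (hstep : ∀ k : ℕ, 1 ≤ k → w k * (1 + l / (k + c)) ≤ w (k + 1)) {β : ℕ} (hβ : 1 ≤ β) :
    ENNReal.ofReal ((1 - l)⁻¹ * w β) ≤
      ∑' i : ℕ, ENNReal.ofReal (engelWeight β c (β + i : ℕ)) * ENNReal.ofReal (w (β + i)) := by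
  have hl1 : 0 < 1 - l := by linarith [(abs_le.1 hl).2]
  have hβ' : (0 : ℝ) < β := by exact_mod_cast hβ
  have key : ∀ N : ℕ, w β - (β + c) / ((β + N : ℕ) + c) * w (β + N) ≤
      (1 - l) * ∑ i ∈ Finset.range N, engelWeight β c (β + i : ℕ) * w (β + i) := by
    intro N
    induction N with
    | zero =>
      have : ((β : ℝ) + c) / (β + c) = 1 := div_self (by positivity)
      simp [this]
    | succ N ih =>
      rw [Finset.sum_range_succ, mul_add]
      have hk : (0 : ℝ) < (β + N : ℕ) := by exact_mod_cast Nat.lt_of_lt_of_le hβ (by omega)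
      have h1 := one_sub_mul_engelWeight (β := β) l hc hk
      have h2 := mul_le_mul_of_nonneg_left (hstep (β + N) (by omega))
        (show 0 ≤ ((β : ℝ) + c) / ((β + N : ℕ) + 1 + c) by positivity)
      have h3 : (1 - l) * (engelWeight β c (β + N : ℕ) * w (β + N)) =
          ((β + c) / ((β + N : ℕ) + c) -
            (β + c) / ((β + N : ℕ) + 1 + c) * (1 + l / ((β + N : ℕ) + c))) * w (β + N) := by
        rw [← h1]
        ring
      rw [h3, ← add_assoc β N 1, Nat.cast_add (β + N) 1, Nat.cast_one]
      linarith
  have hlim : Tendsto (fun N : ℕ => ENNReal.ofReal ((1 - l)⁻¹ *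
      (w β - (β + c) / ((β + N : ℕ) + c) * w (β + N)))) atTop
      (𝓝 (ENNReal.ofReal ((1 - l)⁻¹ * w β))) := by
    apply ENNReal.tendsto_ofReal
    have := ((tendsto_tail_mul hc hw hK hβ).const_sub (w β)).const_mul (1 - l)⁻¹
    rwa [sub_zero] at this
  refine le_of_tendsto' hlim fun N => le_trans ?_ (ENNReal.sum_le_tsum (Finset.range N))
  have hterm : ∀ i ∈ Finset.range N, ENNReal.ofReal (engelWeight β c (β + i : ℕ)) *
      ENNReal.ofReal (w (β + i)) = ENNReal.ofReal (engelWeight β c (β + i : ℕ) * w (β + i)) :=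
    fun i _ => (ENNReal.ofReal_mul
      (engelWeight_nonneg hβ'.le hc (Nat.cast_nonneg _))).symm
  rw [Finset.sum_congr rfl hterm, ← ENNReal.ofReal_sum_of_nonneg fun i _ =>
    mul_nonneg (engelWeight_nonneg hβ'.le hc (Nat.cast_nonneg _)) (hw _)]
  apply ENNReal.ofReal_le_ofReal
  rw [inv_mul_eq_div, div_le_iff₀ hl1, mul_comm]
  linarith [key N]

theorem div_add_mem_Icc {k : ℕ} (hk : 1 ≤ k) {c : ℝ} (hc : 0 ≤ c) :
    (k : ℝ) / (k + c) ∈ Set.Icc (0 : ℝ) 1 := by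
  have hk' : (0 : ℝ) < k := by exact_mod_cast hk
  refine ⟨by positivity, ?_⟩
  rw [div_le_one (by positivity)]
  linarith

/-- Each transition costs a factor `(1 - l)⁻¹`. The step condition is needed for all `c ∈ [0, 1]` at
once, since the induction replaces `c` by `k / (k + c)`. -/
theorem engelExpectation_le {l : ℝ} (hl : |l| ≤ 1 / 2) {w : ℕ → ℝ} (hw : ∀ k, 0 ≤ w k)
    (hstep : ∀ c ∈ Set.Icc (0 : ℝ) 1, ∀ k : ℕ, 1 ≤ k → w (k + 1) ≤ w k * (1 + l / (k + c)))
    {φ : ℕ → ℝ≥0∞} {C : ℝ≥0∞} (hφ : ∀ k, 1 ≤ k → φ k ≤ C * ENNReal.ofReal (w k)) (n : ℕ) :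
    ∀ β : ℕ, 1 ≤ β → ∀ c ∈ Set.Icc (0 : ℝ) 1, engelExpectation φ n β c ≤
      C * ENNReal.ofReal ((1 - l)⁻¹ ^ (n + 1) * w β) := by
  have hl1 : 0 < 1 - l := by linarith [(abs_le.1 hl).2]
  induction n with
  | zero =>
    intro β hβ c hc
    rw [engelExpectation_zero φ hβ hc.1, zero_add, pow_one]
    refine le_trans ?_ (mul_le_mul_right (sum_engelWeight_mul_le hl hc.1 hw (hstep c hc) hβ) C)
    rw [← ENNReal.tsum_mul_left]
    refine ENNReal.tsum_le_tsum fun i => ?_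
    rw [mul_left_comm]
    gcongr
    exact hφ _ (by omega)
  | succ n ih =>
    intro β hβ c hc
    rw [engelExpectation_succ φ n hβ hc.1, pow_succ, mul_assoc,
      ENNReal.ofReal_mul (by positivity)]
    refine le_trans ?_ (mul_le_mul_right (mul_le_mul_right
      (sum_engelWeight_mul_le hl hc.1 hw (hstep c hc) hβ) _) C)
    rw [← ENNReal.tsum_mul_left, ← ENNReal.tsum_mul_left]
    refine ENNReal.tsum_le_tsum fun i => ?_
    refine (mul_le_mul_right (ih (β + i) (by omega) _
      (div_add_mem_Icc (by omega) hc.1)) _).trans (le_of_eq ?_)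
    rw [ENNReal.ofReal_mul (by positivity)]
    ring

theorem le_engelExpectation {l : ℝ} (hl : |l| ≤ 1 / 2) {w : ℕ → ℝ} {K : ℝ} (hw : ∀ k, 0 ≤ w k)
    (hK : ∀ k : ℕ, 1 ≤ k → w k ≤ K * (k : ℝ) ^ (1 / 2 : ℝ))
    (hstep : ∀ c ∈ Set.Icc (0 : ℝ) 1, ∀ k : ℕ, 1 ≤ k → w k * (1 + l / (k + c)) ≤ w (k + 1))
    {φ : ℕ → ℝ≥0∞} {C : ℝ≥0∞} (hφ : ∀ k, 1 ≤ k → C * ENNReal.ofReal (w k) ≤ φ k) (n : ℕ) :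
    ∀ β : ℕ, 1 ≤ β → ∀ c ∈ Set.Icc (0 : ℝ) 1,
      C * ENNReal.ofReal ((1 - l)⁻¹ ^ (n + 1) * w β) ≤ engelExpectation φ n β c := by
  have hl1 : 0 < 1 - l := by linarith [(abs_le.1 hl).2]
  induction n with
  | zero =>
    intro β hβ c hc
    rw [engelExpectation_zero φ hβ hc.1, zero_add, pow_one]
    refine le_trans (mul_le_mul_right (le_sum_engelWeight_mul hl hc.1 hw hK (hstep c hc) hβ) C) ?_
    rw [← ENNReal.tsum_mul_left]
    refine ENNReal.tsum_le_tsum fun i => ?_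
    rw [mul_left_comm]
    gcongr
    exact hφ _ (by omega)
  | succ n ih =>
    intro β hβ c hc
    rw [engelExpectation_succ φ n hβ hc.1, pow_succ, mul_assoc,
      ENNReal.ofReal_mul (by positivity)]
    refine le_trans (mul_le_mul_right (mul_le_mul_right
      (le_sum_engelWeight_mul hl hc.1 hw hK (hstep c hc) hβ) _) C) ?_
    rw [← ENNReal.tsum_mul_left, ← ENNReal.tsum_mul_left]
    refine ENNReal.tsum_le_tsum fun i => ?_
    refine le_trans (le_of_eq ?_) (mul_le_mul_right (ih (β + i) (by omega) _
      (div_add_mem_Icc (by omega) hc.1)) _)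
    rw [ENNReal.ofReal_mul (by positivity)]
    ring

/-! ### Sub- and super-eigenfunctions, and the moments -/

theorem harmonicProd_bounds_pred {l : ℝ} (hl : |l| ≤ 1 / 2) {k : ℕ} (hk : 1 ≤ k) :
    1 / 4 * (k : ℝ) ^ l ≤ harmonicProd l (k - 1) ∧ harmonicProd l (k - 1) ≤ 4 * (k : ℝ) ^ l := by
  have h := harmonicProd_bounds hl (k - 1)
  have e : ((k - 1 : ℕ) : ℝ) + 1 = k := by
    rw [Nat.cast_sub hk]
    simp
  rw [e] at h
  have : 0 ≤ (k : ℝ) ^ l := by positivity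
  constructor <;> linarith [h.1, h.2]

theorem harmonicProd_bounds_self {l : ℝ} (hl : |l| ≤ 1 / 2) {k : ℕ} (hk : 1 ≤ k) :
    1 / 4 * (k : ℝ) ^ l ≤ harmonicProd l k ∧ harmonicProd l k ≤ 4 * (k : ℝ) ^ l := by
  have h := harmonicProd_bounds hl k
  have hk' : (1 : ℝ) ≤ k := by exact_mod_cast hk
  have hk0 : (0 : ℝ) < k := by linarith
  have hr : 0 < (k : ℝ) ^ l := by positivity
  obtain ⟨hl1, hl2⟩ := abs_le.1 hl
  have e : (k : ℝ) + 1 ≤ 2 * k := by linarith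
  have hmul : (2 * (k : ℝ)) ^ l = 2 ^ l * (k : ℝ) ^ l := Real.mul_rpow (by norm_num) hk0.le
  rcases le_total 0 l with h0 | h0
  · have a1 := Real.rpow_le_rpow hk0.le (show (k : ℝ) ≤ k + 1 by linarith) h0
    have a2 := Real.rpow_le_rpow (by positivity) e h0
    have a3 : (2 : ℝ) ^ l ≤ 2 ^ (1 : ℝ) :=
      Real.rpow_le_rpow_of_exponent_le (by norm_num) (by linarith)
    rw [Real.rpow_one] at a3
    constructor <;> nlinarith [h.1, h.2]
  · have a1 := Real.rpow_le_rpow_of_nonpos hk0 (show (k : ℝ) ≤ k + 1 by linarith) h0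
    have a2 := Real.rpow_le_rpow_of_nonpos (by positivity) e h0
    have a3 : (2 : ℝ) ^ (-1 : ℝ) ≤ 2 ^ l :=
      Real.rpow_le_rpow_of_exponent_le (by norm_num) (by linarith)
    rw [Real.rpow_neg_one] at a3
    constructor <;> nlinarith [h.1, h.2]

theorem harmonicProd_succ_pred (l : ℝ) {k : ℕ} (hk : 1 ≤ k) :
    harmonicProd l (k + 1 - 1) = harmonicProd l (k - 1) * (1 + l / k) := by
  obtain ⟨j, rfl⟩ := Nat.exists_eq_add_of_le' hk
  simp only [Nat.add_sub_cancel, harmonicProd_succ, Nat.cast_add, Nat.cast_one]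

/-- The ratio `1 + l / (k + c)` lies between `1 + l / (k + 1)` and `1 + l / k`, the ratios of
`harmonicProd l k` and of `harmonicProd l (k - 1)`. The sign of `l` decides which one is smaller. -/
theorem exists_super_eigenfunction {l : ℝ} (hl : |l| ≤ 1 / 2) :
    ∃ w : ℕ → ℝ, (∀ k, 0 ≤ w k) ∧
      (∀ k : ℕ, 1 ≤ k → 1 / 4 * (k : ℝ) ^ l ≤ w k ∧ w k ≤ 4 * (k : ℝ) ^ l) ∧
      ∀ c ∈ Set.Icc (0 : ℝ) 1, ∀ k : ℕ, 1 ≤ k → w (k + 1) ≤ w k * (1 + l / (k + c)) := by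
  rcases le_total 0 l with h0 | h0
  · refine ⟨harmonicProd l, fun k => (harmonicProd_pos hl k).le,
      fun k hk => harmonicProd_bounds_self hl hk, fun c hc k hk => ?_⟩
    have hk' : (0 : ℝ) < k := by exact_mod_cast hk
    rw [harmonicProd_succ]
    refine mul_le_mul_of_nonneg_left ?_ (harmonicProd_pos hl k).le
    have := div_le_div_of_nonneg_left h0 (show 0 < (k : ℝ) + c by linarith [hc.1])
      (show (k : ℝ) + c ≤ k + 1 by linarith [hc.2])
    linarith
  · refine ⟨fun k => harmonicProd l (k - 1), fun k => (harmonicProd_pos hl _).le,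
      fun k hk => harmonicProd_bounds_pred hl hk, fun c hc k hk => ?_⟩
    have hk' : (0 : ℝ) < k := by exact_mod_cast hk
    simp only [harmonicProd_succ_pred l hk]
    refine mul_le_mul_of_nonneg_left ?_ (harmonicProd_pos hl _).le
    have := div_le_div_of_nonneg_left (neg_nonneg.2 h0) hk'
      (show (k : ℝ) ≤ k + c by linarith [hc.1])
    rw [neg_div, neg_div] at this
    linarith

theorem exists_sub_eigenfunction {l : ℝ} (hl : |l| ≤ 1 / 2) :
    ∃ w : ℕ → ℝ, (∀ k, 0 ≤ w k) ∧
      (∀ k : ℕ, 1 ≤ k → 1 / 4 * (k : ℝ) ^ l ≤ w k ∧ w k ≤ 4 * (k : ℝ) ^ l) ∧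
      ∀ c ∈ Set.Icc (0 : ℝ) 1, ∀ k : ℕ, 1 ≤ k → w k * (1 + l / (k + c)) ≤ w (k + 1) := by
  rcases le_total 0 l with h0 | h0
  · refine ⟨fun k => harmonicProd l (k - 1), fun k => (harmonicProd_pos hl _).le,
      fun k hk => harmonicProd_bounds_pred hl hk, fun c hc k hk => ?_⟩
    have hk' : (0 : ℝ) < k := by exact_mod_cast hk
    simp only [harmonicProd_succ_pred l hk]
    refine mul_le_mul_of_nonneg_left ?_ (harmonicProd_pos hl _).le
    have := div_le_div_of_nonneg_left h0 hk' (show (k : ℝ) ≤ k + c by linarith [hc.1])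
    linarith
  · refine ⟨harmonicProd l, fun k => (harmonicProd_pos hl k).le,
      fun k hk => harmonicProd_bounds_self hl hk, fun c hc k hk => ?_⟩
    have hk' : (0 : ℝ) < k := by exact_mod_cast hk
    rw [harmonicProd_succ]
    refine mul_le_mul_of_nonneg_left ?_ (harmonicProd_pos hl k).le
    have := div_le_div_of_nonneg_left (neg_nonneg.2 h0)
      (show 0 < (k : ℝ) + c by linarith [hc.1]) (show (k : ℝ) + c ≤ k + 1 by linarith [hc.2])
    rw [neg_div, neg_div] at this
    linarith

theorem lintegral_eq_engelExpectation (φ : ℕ → ℝ≥0∞) (n : ℕ) :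
    ∫⁻ x in Set.Ioc (0 : ℝ) 1, φ (engelPartialQuotient (n + 1) x) =
      engelExpectation φ n 1 0 := by
  simp [engelExpectation, engelDensity]

theorem exp_mul_log_natCast (l : ℝ) {k : ℕ} (hk : 1 ≤ k) :
    Real.exp (l * Real.log k) = (k : ℝ) ^ l := by
  have hk' : (0 : ℝ) < k := by exact_mod_cast hk
  rw [Real.rpow_def_of_pos hk', mul_comm]

/-- The moments of order `l` of the partial quotients, up to a constant factor. -/
theorem lintegral_engelPartialQuotient_bounds {l : ℝ} (hl : |l| ≤ 1 / 2) {n : ℕ} (hn : 1 ≤ n) :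
    ENNReal.ofReal (1 / 16 * (1 - l)⁻¹ ^ n) ≤
        ∫⁻ x in Set.Ioc (0 : ℝ) 1,
          ENNReal.ofReal (Real.exp (l * Real.log (engelPartialQuotient n x : ℝ))) ∧
      ∫⁻ x in Set.Ioc (0 : ℝ) 1,
          ENNReal.ofReal (Real.exp (l * Real.log (engelPartialQuotient n x : ℝ))) ≤
        ENNReal.ofReal (16 * (1 - l)⁻¹ ^ n) := by
  obtain ⟨m, rfl⟩ := Nat.exists_eq_add_of_le' hn
  have hl1 : 0 < 1 - l := by linarith [(abs_le.1 hl).2]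
  have hpow : 0 ≤ (1 - l)⁻¹ ^ (m + 1) := by positivity
  have h01 : (0 : ℝ) ∈ Set.Icc (0 : ℝ) 1 := ⟨le_rfl, zero_le_one⟩
  rw [lintegral_eq_engelExpectation
    (fun k => ENNReal.ofReal (Real.exp (l * Real.log (k : ℝ)))) m]
  constructor
  · obtain ⟨w, hw, hb, hstep⟩ := exists_sub_eigenfunction hl
    -- One factor `1/4` compares `k ^ l` with `w k`, the other bounds `w 1`; together they give
    -- `1/16`.
    refine le_trans ?_ (le_engelExpectation hl (K := 4) hw (fun k hk => ?_) hstep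
      (C := ENNReal.ofReal (1 / 4)) (fun k hk => ?_) m 1 le_rfl 0 h01)
    · rw [← ENNReal.ofReal_mul (by norm_num)]
      apply ENNReal.ofReal_le_ofReal
      have := (hb 1 le_rfl).1
      simp only [Nat.cast_one, Real.one_rpow] at this
      nlinarith
    · refine (hb k hk).2.trans ?_
      have hk' : (1 : ℝ) ≤ k := by exact_mod_cast hk
      have := Real.rpow_le_rpow_of_exponent_le hk' (abs_le.1 hl).2
      linarith
    · rw [← ENNReal.ofReal_mul (by norm_num), exp_mul_log_natCast l hk]
      apply ENNReal.ofReal_le_ofReal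
      linarith [(hb k hk).2]
  · obtain ⟨w, hw, hb, hstep⟩ := exists_super_eigenfunction hl
    refine (engelExpectation_le hl hw hstep
      (C := ENNReal.ofReal 4) (fun k hk => ?_) m 1 le_rfl 0 h01).trans ?_
    · rw [← ENNReal.ofReal_mul (by norm_num), exp_mul_log_natCast l hk]
      apply ENNReal.ofReal_le_ofReal
      linarith [(hb k hk).1]
    · rw [← ENNReal.ofReal_mul (by norm_num)]
      apply ENNReal.ofReal_le_ofReal
      have := (hb 1 le_rfl).2
      simp only [Nat.cast_one, Real.one_rpow] at this
      nlinarith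

/-! ### Gärtner–Ellis for a quadratic limit -/

section GaussianDeviation

variable {Ω : Type*} [MeasurableSpace Ω] {P : Measure Ω} {X : ℕ → Ω → ℝ} {v : ℕ → ℝ}

/-- The scaled logarithmic moment generating functions of `X n` converge to `θ ^ 2 / 2`. -/
def HasGaussianLogMGF (P : Measure Ω) (X : ℕ → Ω → ℝ) (v : ℕ → ℝ) : Prop :=
  ∀ θ δ : ℝ, 0 < δ → ∀ᶠ n in atTop,
    ENNReal.ofReal (Real.exp (v n * (θ ^ 2 / 2 - δ))) ≤
        ∫⁻ ω, ENNReal.ofReal (Real.exp (v n * (θ * X n ω))) ∂P ∧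
      ∫⁻ ω, ENNReal.ofReal (Real.exp (v n * (θ * X n ω))) ∂P ≤
        ENNReal.ofReal (Real.exp (v n * (θ ^ 2 / 2 + δ)))

/-- Exponential Markov inequality under a tilt: `Z = 0` gives Chernoff's bound, a linear `Z`
controls the tails of a tilted measure. -/
theorem setLIntegral_exp_le_of_lintegral_exp_le {Y Z : Ω → ℝ} (hY : Measurable Y) {s t : ℝ}
    (hZ : ∫⁻ ω, ENNReal.ofReal (Real.exp (Y ω)) ∂P ≤ ENNReal.ofReal (Real.exp t))
    (A : Set Ω) (hA : ∀ ω ∈ A, Z ω + s ≤ Y ω) (hAm : MeasurableSet A) :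
    ∫⁻ ω in A, ENNReal.ofReal (Real.exp (Z ω)) ∂P ≤ ENNReal.ofReal (Real.exp (t - s)) := by
  calc ∫⁻ ω in A, ENNReal.ofReal (Real.exp (Z ω)) ∂P
      ≤ ∫⁻ ω in A, ENNReal.ofReal (Real.exp (-s)) * ENNReal.ofReal (Real.exp (Y ω)) ∂P := by
        refine setLIntegral_mono' hAm fun ω hω => ?_
        rw [← ENNReal.ofReal_mul (Real.exp_pos _).le, ← Real.exp_add]
        exact ENNReal.ofReal_le_ofReal (Real.exp_le_exp.2 (by linarith [hA ω hω]))
    _ ≤ ∫⁻ ω, ENNReal.ofReal (Real.exp (-s)) * ENNReal.ofReal (Real.exp (Y ω)) ∂P :=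
        setLIntegral_le_lintegral _ _
    _ = ENNReal.ofReal (Real.exp (-s)) * ∫⁻ ω, ENNReal.ofReal (Real.exp (Y ω)) ∂P :=
        lintegral_const_mul _ (Real.measurable_exp.comp hY).ennreal_ofReal
    _ ≤ ENNReal.ofReal (Real.exp (-s)) * ENNReal.ofReal (Real.exp t) := by gcongr
    _ = ENNReal.ofReal (Real.exp (t - s)) := by
        rw [← ENNReal.ofReal_mul (Real.exp_pos _).le, ← Real.exp_add]
        congr 2
        ring

theorem eventually_const_le_mul (hv : Tendsto v atTop atTop) {δ : ℝ} (hδ : 0 < δ) (C : ℝ) :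
    ∀ᶠ n in atTop, 0 < v n ∧ C ≤ v n * δ := by
  filter_upwards [hv.eventually_ge_atTop (C / δ), hv.eventually_gt_atTop 0] with n h1 h2
  exact ⟨h2, (div_le_iff₀ hδ).1 h1⟩

theorem eventually_measurable (hX : ∀ n, 1 ≤ n → Measurable (X n)) :
    ∀ᶠ n in atTop, Measurable (X n) := by
  filter_upwards [eventually_ge_atTop 1] with n hn using hX n hn

/-- Chernoff's bound for both tails. -/
theorem HasGaussianLogMGF.measure_abs_ge_le (h : HasGaussianLogMGF P X v)
    (hX : ∀ n, 1 ≤ n → Measurable (X n)) (hv : Tendsto v atTop atTop) {r δ : ℝ} (hr : 0 ≤ r)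
    (hδ : 0 < δ) :
    ∀ᶠ n in atTop, P {ω | r ≤ |X n ω|} ≤ ENNReal.ofReal (Real.exp (v n * (-(r ^ 2 / 2) + δ))) := by
  -- Half of `δ` absorbs the factor 2 from the union of the two tails.
  filter_upwards [eventually_const_le_mul hv (half_pos hδ) (Real.log 2), eventually_measurable hX,
    h r (δ / 2) (half_pos hδ), h (-r) (δ / 2) (half_pos hδ)] with n ⟨hvn, hlog⟩ hXn h1 h2
  have hp1 := setLIntegral_exp_le_of_lintegral_exp_le (P := P) (Z := fun _ => 0) (s := v n * r ^ 2)
    ((hXn.const_mul r).const_mul (v n)) h1.2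
    {ω | r ≤ X n ω} (fun ω (hω : r ≤ X n ω) => by
      rw [zero_add]
      refine mul_le_mul_of_nonneg_left ?_ hvn.le
      nlinarith) (measurableSet_le measurable_const hXn)
  have hp2 := setLIntegral_exp_le_of_lintegral_exp_le (P := P) (Z := fun _ => 0) (s := v n * r ^ 2)
    ((hXn.const_mul (-r)).const_mul (v n)) h2.2
    {ω | X n ω ≤ -r} (fun ω (hω : X n ω ≤ -r) => by
      rw [zero_add]
      refine mul_le_mul_of_nonneg_left ?_ hvn.le
      nlinarith) (measurableSet_le hXn measurable_const)
  simp only [Real.exp_zero, ENNReal.ofReal_one, lintegral_one, Measure.restrict_apply_univ]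
    at hp1 hp2
  have hsub : {ω | r ≤ |X n ω|} ⊆ {ω | r ≤ X n ω} ∪ {ω | X n ω ≤ -r} := by
    intro ω hω
    rcases le_abs.1 (show r ≤ |X n ω| from hω) with h | h
    · exact Or.inl h
    · exact Or.inr (show X n ω ≤ -r by linarith)
  refine (measure_mono hsub).trans ((measure_union_le _ _).trans ((add_le_add hp1 hp2).trans ?_))
  rw [neg_sq, ← ENNReal.ofReal_add (Real.exp_pos _).le (Real.exp_pos _).le]
  apply ENNReal.ofReal_le_ofReal
  rw [← two_mul]
  nth_rw 1 [← Real.exp_log (show (0 : ℝ) < 2 by norm_num)]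
  rw [← Real.exp_add]
  apply Real.exp_le_exp.2
  nlinarith

/-- The tilting lower bound for small intervals. -/
theorem HasGaussianLogMGF.le_measure_abs_sub_lt [IsProbabilityMeasure P]
    (h : HasGaussianLogMGF P X v) (hX : ∀ n, 1 ≤ n → Measurable (X n))
    (hv : Tendsto v atTop atTop) (x : ℝ) {ε δ : ℝ} (hε : 0 < ε) (hδ : 0 < δ) :
    ∀ᶠ n in atTop, ENNReal.ofReal (Real.exp (v n * (-(x ^ 2 / 2) - δ))) ≤
      P {ω | |X n ω - x| < ε} := by
  -- A smaller radius keeps the tilt `exp (v n * (x * X n))` within `exp (v n * δ / 2)` of its value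
  -- at `X n = x`, from above.
  set e := min ε (δ / (2 * (|x| + 1))) with he
  have hx1 : 0 < |x| + 1 := by positivity
  have he0 : 0 < e := lt_min hε (by positivity)
  have heε : e ≤ ε := min_le_left _ _
  have hex : |x| * e ≤ δ / 2 := by
    have h1 : e * (2 * (|x| + 1)) ≤ δ := (le_div_iff₀ (by positivity)).1 (min_le_right _ _)
    nlinarith
  set η := min (e ^ 2 / 8) (δ / 4) with hη
  have hη0 : 0 < η := lt_min (by positivity) (by positivity)
  have hη1 : η ≤ e ^ 2 / 8 := min_le_left _ _
  have hη2 : η ≤ δ / 4 := min_le_right _ _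
  filter_upwards [eventually_const_le_mul hv (show 0 < δ / 4 by positivity) (Real.log 2),
    eventually_const_le_mul hv (show 0 < e ^ 2 / 4 by positivity) (Real.log 4),
    eventually_measurable hX, h x η hη0, h (x + e) η hη0, h (x - e) η hη0]
    with n ⟨hvn, hlog2⟩ ⟨_, hlog4⟩ hXn h0 h1 h2
  set A := {ω | |X n ω - x| < e} with hAdef
  set B := {ω | x + e ≤ X n ω} with hBdef
  set D := {ω | X n ω ≤ x - e} with hDdef
  have hA : ∫⁻ ω in A, ENNReal.ofReal (Real.exp (v n * (x * X n ω))) ∂P ≤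
      ENNReal.ofReal (Real.exp (v n * (x ^ 2 + δ / 2))) * P A := by
    have hAm : MeasurableSet A :=
      measurableSet_lt (hXn.sub_const x).abs measurable_const
    rw [← setLIntegral_const]
    refine setLIntegral_mono' hAm fun ω hω => ?_
    apply ENNReal.ofReal_le_ofReal
    apply Real.exp_le_exp.2
    refine mul_le_mul_of_nonneg_left ?_ hvn.le
    have h3 : x * (X n ω - x) ≤ |x| * e := by
      refine (le_abs_self _).trans ?_
      rw [abs_mul]
      exact mul_le_mul_of_nonneg_left (le_of_lt hω) (abs_nonneg x)
    nlinarith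
  -- Moving the tilt from `x` to `x + e` gains `e² / 2`, as `(x + e)² / 2 - e (x + e) = x² / 2 - e²
  -- / 2`. The left tail is symmetric.
  have hB := setLIntegral_exp_le_of_lintegral_exp_le (P := P) (Z := fun ω => v n * (x * X n ω))
    (s := v n * (e * (x + e))) ((hXn.const_mul (x + e)).const_mul (v n)) h1.2 B
    (fun ω (hω : x + e ≤ X n ω) => by
      rw [← mul_add]
      refine mul_le_mul_of_nonneg_left ?_ hvn.le
      nlinarith) (measurableSet_le measurable_const hXn)
  have hD := setLIntegral_exp_le_of_lintegral_exp_le (P := P) (Z := fun ω => v n * (x * X n ω))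
    (s := v n * (-e * (x - e))) ((hXn.const_mul (x - e)).const_mul (v n)) h2.2 D
    (fun ω (hω : X n ω ≤ x - e) => by
      rw [← mul_add]
      refine mul_le_mul_of_nonneg_left ?_ hvn.le
      nlinarith) (measurableSet_le hXn measurable_const)
  have hcover : A ∪ (B ∪ D) = Set.univ := by
    refine Set.eq_univ_of_forall fun ω => ?_
    by_cases hω : |X n ω - x| < e
    · exact Or.inl hω
    · rcases le_abs.1 (not_lt.1 hω) with h | h
      · exact Or.inr (Or.inl (show x + e ≤ X n ω by linarith))
      · exact Or.inr (Or.inr (show X n ω ≤ x - e by linarith))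
  have htotal : ENNReal.ofReal (Real.exp (v n * (x ^ 2 / 2 - η))) ≤
      ENNReal.ofReal (Real.exp (v n * (x ^ 2 + δ / 2))) * P A +
        (ENNReal.ofReal (Real.exp (v n * (x ^ 2 / 2 - e ^ 2 / 2 + η))) +
          ENNReal.ofReal (Real.exp (v n * (x ^ 2 / 2 - e ^ 2 / 2 + η)))) := by
    refine h0.1.trans ?_
    rw [← setLIntegral_univ, ← hcover]
    refine (lintegral_union_le _ _ _).trans (add_le_add hA ((lintegral_union_le _ _ _).trans
      (add_le_add (hB.trans (le_of_eq ?_)) (hD.trans (le_of_eq ?_)))))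
    · congr 2
      ring
    · congr 2
      ring
  have hAfin : P A ≠ ⊤ := measure_ne_top P A
  obtain ⟨p, hp0, hp⟩ : ∃ p : ℝ, 0 ≤ p ∧ P A = ENNReal.ofReal p :=
    ⟨(P A).toReal, ENNReal.toReal_nonneg, (ENNReal.ofReal_toReal hAfin).symm⟩
  refine le_trans ?_ (measure_mono (show A ⊆ _ from fun ω hω => lt_of_lt_of_le hω heε))
  rw [hp] at htotal ⊢
  apply ENNReal.ofReal_le_ofReal
  rw [← ENNReal.ofReal_mul (Real.exp_pos _).le,
    ← ENNReal.ofReal_add (Real.exp_pos _).le (Real.exp_pos _).le,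
    ← ENNReal.ofReal_add (by positivity) (by positivity),
    ENNReal.ofReal_le_ofReal_iff (by positivity)] at htotal
  -- Each tail carries at most a quarter of the lower bound for the tilted mass, so `A` carries at
  -- least half of it.
  have h4 : 4 * Real.exp (v n * (x ^ 2 / 2 - e ^ 2 / 2 + η)) ≤
      Real.exp (v n * (x ^ 2 / 2 - η)) := by
    nth_rw 1 [← Real.exp_log (show (0 : ℝ) < 4 by norm_num)]
    rw [← Real.exp_add]
    apply Real.exp_le_exp.2
    nlinarith
  have h5 : 2 * Real.exp (v n * (-(x ^ 2 / 2) - δ)) * Real.exp (v n * (x ^ 2 + δ / 2)) ≤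
      Real.exp (v n * (x ^ 2 / 2 - η)) := by
    nth_rw 1 [← Real.exp_log (show (0 : ℝ) < 2 by norm_num)]
    rw [← Real.exp_add, ← Real.exp_add]
    apply Real.exp_le_exp.2
    nlinarith
  have h6 : Real.exp (v n * (-(x ^ 2 / 2) - δ)) * Real.exp (v n * (x ^ 2 + δ / 2)) ≤
      p * Real.exp (v n * (x ^ 2 + δ / 2)) := by linarith
  exact le_of_mul_le_mul_right h6 (Real.exp_pos _)

theorem isGoodRateFunction_sq_div_two :
    IsGoodRateFunction fun x : ℝ => ENNReal.ofReal (x ^ 2 / 2) := by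
  have hcont : Continuous fun x : ℝ => ENNReal.ofReal (x ^ 2 / 2) :=
    ENNReal.continuous_ofReal.comp (by fun_prop)
  refine ⟨hcont.lowerSemicontinuous, fun c => ?_⟩
  refine (isCompact_Icc (a := -(2 * (c : ℝ) + 1)) (b := 2 * (c : ℝ) + 1)).of_isClosed_subset
    (isClosed_le hcont continuous_const) fun x hx => ?_
  have h1 : x ^ 2 / 2 ≤ c := by
    have h2 : ENNReal.ofReal (x ^ 2 / 2) ≤ ENNReal.ofReal (c : ℝ) := by
      rw [ENNReal.ofReal_coe_nnreal]
      exact hx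
    exact (ENNReal.ofReal_le_ofReal_iff c.2).1 h2
  have hc : (0 : ℝ) ≤ c := c.2
  exact ⟨by nlinarith [sq_nonneg (x + 1)], by nlinarith [sq_nonneg (x - 1)]⟩

theorem inv_mul_log_ofReal_exp {u : ℝ} (hu : 0 < u) (s : ℝ) :
    ((1 / u : ℝ) : EReal) * ENNReal.log (ENNReal.ofReal (Real.exp (u * s))) = (s : EReal) := by
  rw [ENNReal.log_ofReal_of_pos (Real.exp_pos _), Real.log_exp, ← EReal.coe_mul]
  congr 1
  field_simp

theorem coe_ofReal_sq_div_two (x : ℝ) :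
    ((ENNReal.ofReal (x ^ 2 / 2) : ℝ≥0∞) : EReal) = ((x ^ 2 / 2 : ℝ) : EReal) := by
  rw [EReal.coe_ennreal_ofReal, max_eq_left (by positivity)]

/-- The Gärtner–Ellis theorem for a quadratic limit of the logarithmic moment generating
functions. -/
theorem HasGaussianLogMGF.satisfiesDeviationPrinciple [IsProbabilityMeasure P]
    (h : HasGaussianLogMGF P X v) (hX : ∀ n, 1 ≤ n → Measurable (X n))
    (hvpos : ∀ n, 1 ≤ n → 0 < v n) (hv : Tendsto v atTop atTop) :
    SatisfiesDeviationPrinciple P X v fun x => ENNReal.ofReal (x ^ 2 / 2) := by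
  refine ⟨hX, hvpos, hv, isGoodRateFunction_sq_div_two, fun Γ _ => ⟨?_, liminf_le_limsup, ?_⟩⟩
  · rw [EReal.neg_le]
    refine le_iInf₂ fun x hx => ?_
    rw [coe_ofReal_sq_div_two, EReal.neg_le, ← EReal.coe_neg]
    refine le_of_forall_lt fun c hc => ?_
    obtain ⟨c₁, hc₁, hc₁'⟩ := EReal.lt_iff_exists_real_btwn.1 hc
    refine hc₁.trans_le ?_
    have hδ : 0 < -(x ^ 2 / 2) - c₁ := sub_pos.2 (EReal.coe_lt_coe_iff.1 hc₁')
    obtain ⟨ε, hε, hball⟩ := Metric.isOpen_iff.1 isOpen_interior x hx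
    refine le_liminf_of_le (by isBoundedDefault) ?_
    filter_upwards [h.le_measure_abs_sub_lt hX hv x hε hδ, hv.eventually_gt_atTop 0] with n hn hvn
    rw [sub_sub_cancel] at hn
    rw [← inv_mul_log_ofReal_exp hvn c₁]
    refine mul_le_mul_of_nonneg_left (ENNReal.log_le_log (hn.trans (measure_mono fun ω hω => ?_)))
      (EReal.coe_nonneg.2 (by positivity))
    have hmem : X n ω ∈ interior Γ := hball (by rwa [Metric.mem_ball, Real.dist_eq])
    have hmemΓ : X n ω ∈ Γ := interior_subset hmem
    exact hmemΓ
  · rw [EReal.le_neg]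
    refine le_of_forall_lt fun c hc => ?_
    obtain ⟨c₁, hc₁, hc₁'⟩ := EReal.lt_iff_exists_real_btwn.1 hc
    obtain ⟨c₂, hc₂, hc₂'⟩ := EReal.lt_iff_exists_real_btwn.1 hc₁'
    refine hc₁.trans_le ?_
    rw [EReal.le_neg, ← EReal.coe_neg]
    have hδ : 0 < c₂ - c₁ := sub_pos.2 (EReal.coe_lt_coe_iff.1 hc₂)
    -- Every point of `Γ` has rate above `c₂`, so `Γ` lies outside the interval of this radius and
    -- the two-sided Chernoff bound suffices. The maximum covers negative `c₂`.
    have hr : Real.sqrt (2 * max c₂ 0) ^ 2 = 2 * max c₂ 0 := Real.sq_sqrt (by positivity)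
    have hsub : ∀ y ∈ Γ, Real.sqrt (2 * max c₂ 0) ≤ |y| := by
      intro y hy
      apply Real.sqrt_le_iff.2 ⟨abs_nonneg y, ?_⟩
      have h1 := hc₂'.trans_le (iInf₂_le y (subset_closure hy))
      rw [coe_ofReal_sq_div_two] at h1
      have h2 := EReal.coe_lt_coe_iff.1 h1
      rw [sq_abs]
      have h3 : max c₂ 0 ≤ y ^ 2 / 2 := max_le h2.le (by positivity)
      linarith
    refine limsup_le_of_le (by isBoundedDefault) ?_
    filter_upwards [h.measure_abs_ge_le hX hv (Real.sqrt_nonneg (2 * max c₂ 0)) hδ,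
      hv.eventually_gt_atTop 0] with n hn hvn
    rw [← inv_mul_log_ofReal_exp hvn (-c₁)]
    refine mul_le_mul_of_nonneg_left (ENNReal.log_le_log ?_) (EReal.coe_nonneg.2 (by positivity))
    have hΓ : {ω | X n ω ∈ Γ} ⊆ {ω | Real.sqrt (2 * max c₂ 0) ≤ |X n ω|} := fun ω hω => hsub _ hω
    refine (measure_mono hΓ).trans (hn.trans ?_)
    apply ENNReal.ofReal_le_ofReal
    apply Real.exp_le_exp.2
    refine mul_le_mul_of_nonneg_left ?_ hvn.le
    rw [hr]
    linarith [le_max_left c₂ 0]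

end GaussianDeviation

/-! ### The moderate deviation scaling -/

theorem abs_neg_log_one_sub_sub_le {l : ℝ} (hl : |l| ≤ 1 / 2) :
    |-Real.log (1 - l) - l - l ^ 2 / 2| ≤ 2 * |l| * l ^ 2 := by
  have h := Real.abs_log_sub_add_sum_range_le (x := l) (by linarith) 2
  rw [Finset.sum_range_succ, Finset.sum_range_one] at h
  norm_num at h
  have e : -Real.log (1 - l) - l - l ^ 2 / 2 = -(l + l ^ 2 / 2 + Real.log (1 - l)) := by ring
  rw [e, abs_neg]
  refine h.trans ?_
  rw [div_le_iff₀ (by linarith), ← sq_abs l]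
  nlinarith [pow_nonneg (abs_nonneg l) 3]

/-- Once `a n ≥ √(n log n)`, the speed is at least `log n`. -/
theorem tendsto_sq_div_atTop {a : ℕ → ℝ}
    (ha : Tendsto (fun n : ℕ => a n / Real.sqrt ((n : ℝ) * Real.log (n : ℝ))) atTop atTop) :
    Tendsto (fun n : ℕ => a n ^ 2 / (n : ℝ)) atTop atTop := by
  have hlog : Tendsto (fun n : ℕ => Real.log (n : ℝ)) atTop atTop :=
    Real.tendsto_log_atTop.comp tendsto_natCast_atTop_atTop
  refine tendsto_atTop_mono' _ ?_ hlog
  filter_upwards [ha.eventually_ge_atTop 1, hlog.eventually_gt_atTop 0, eventually_gt_atTop 0]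
    with n h1 h2 h3
  have hn : (0 : ℝ) < n := by exact_mod_cast h3
  have hs : 0 < Real.sqrt ((n : ℝ) * Real.log n) := Real.sqrt_pos.2 (mul_pos hn h2)
  have h4 := (le_div_iff₀ hs).1 h1
  rw [one_mul] at h4
  have h5 := pow_le_pow_left₀ hs.le h4 2
  rw [Real.sq_sqrt (mul_pos hn h2).le] at h5
  rw [le_div_iff₀ hn]
  linarith

theorem hasGaussianLogMGF_engelPartialQuotient {a : ℕ → ℝ} (ha_pos : ∀ n, 1 ≤ n → 0 < a n)
    (hv : Tendsto (fun n : ℕ => a n ^ 2 / (n : ℝ)) atTop atTop)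
    (ha_upper : Tendsto (fun n : ℕ => a n / (n : ℝ)) atTop (𝓝 0)) :
    HasGaussianLogMGF (volume.restrict (Set.Ioc (0 : ℝ) 1))
      (fun n x => (Real.log (engelPartialQuotient n x : ℝ) - (n : ℝ)) / a n)
      (fun n => a n ^ 2 / (n : ℝ)) := by
  intro θ δ hδ
  have hlam : Tendsto (fun n : ℕ => |θ * (a n / n)|) atTop (𝓝 0) := by
    simpa using (ha_upper.const_mul θ).abs
  have hlam2 : Tendsto (fun n : ℕ => 2 * |θ * (a n / n)| * θ ^ 2) atTop (𝓝 0) := by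
    simpa using (hlam.const_mul 2).mul_const (θ ^ 2)
  filter_upwards [hlam.eventually_le_const (show (0 : ℝ) < 1 / 2 by norm_num),
    hlam2.eventually_le_const (half_pos hδ), eventually_ge_atTop 1,
    eventually_const_le_mul hv (half_pos hδ) (Real.log 16)] with n h1 h2 h3 ⟨hvn, h4⟩
  -- With this choice `u * θ * (log b_n - n) / a n = l * log b_n - n * l`, so the moment of order
  -- `l` applies, and `n * l² = u * θ²`. Of the error `u * δ`, one half pays for the cubic Taylor
  -- remainder, the other for `log 16`.
  set l := θ * (a n / n) with hl
  set u := a n ^ 2 / (n : ℝ) with hu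
  have hn : (0 : ℝ) < n := by exact_mod_cast h3
  have han := ha_pos n h3
  have hl1 : 0 < 1 - l := by linarith [(abs_le.1 h1).2]
  have hnl : (n : ℝ) * l ^ 2 = u * θ ^ 2 := by
    rw [hl, hu]
    field_simp
  have hlog : |n * (-Real.log (1 - l) - l) - u * (θ ^ 2 / 2)| ≤ u * (δ / 2) := by
    have e : n * (-Real.log (1 - l) - l) - u * (θ ^ 2 / 2) =
        n * (-Real.log (1 - l) - l - l ^ 2 / 2) := by
      have : (n : ℝ) * (l ^ 2 / 2) = u * (θ ^ 2 / 2) := by linarith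
      rw [mul_sub _ _ (l ^ 2 / 2), this]
    rw [e, abs_mul, abs_of_pos hn]
    calc n * |-Real.log (1 - l) - l - l ^ 2 / 2| ≤ n * (2 * |l| * l ^ 2) :=
          mul_le_mul_of_nonneg_left (abs_neg_log_one_sub_sub_le h1) hn.le
      _ = u * (2 * |l| * θ ^ 2) := by
          rw [show (n : ℝ) * (2 * |l| * l ^ 2) = 2 * |l| * (n * l ^ 2) by ring, hnl]
          ring
      _ ≤ u * (δ / 2) := mul_le_mul_of_nonneg_left h2 hvn.le
  obtain ⟨hlog1, hlog2⟩ := abs_le.1 hlog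
  have hpow : (1 - l)⁻¹ ^ n = Real.exp (n * -Real.log (1 - l)) := by
    rw [← Real.log_inv, Real.exp_nat_mul, Real.exp_log (inv_pos.2 hl1)]
  have h16 : (16 : ℝ) = Real.exp (Real.log 16) := (Real.exp_log (by norm_num)).symm
  have h16' : (1 / 16 : ℝ) = Real.exp (-Real.log 16) := by
    rw [Real.exp_neg, ← h16, one_div]
  have hint : ∫⁻ x in Set.Ioc (0 : ℝ) 1, ENNReal.ofReal (Real.exp
        (u * (θ * ((Real.log (engelPartialQuotient n x : ℝ) - (n : ℝ)) / a n)))) =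
      ENNReal.ofReal (Real.exp (-(n * l))) * ∫⁻ x in Set.Ioc (0 : ℝ) 1,
          ENNReal.ofReal (Real.exp (l * Real.log (engelPartialQuotient n x : ℝ))) := by
    rw [← lintegral_const_mul' _ _ ENNReal.ofReal_ne_top]
    refine lintegral_congr fun x => ?_
    rw [← ENNReal.ofReal_mul (Real.exp_pos _).le, ← Real.exp_add]
    congr 2
    rw [hl, hu]
    field_simp
    ring
  obtain ⟨hlo, hhi⟩ := lintegral_engelPartialQuotient_bounds h1 h3
  rw [hint]
  constructor
  · refine le_trans ?_ (mul_le_mul_right hlo _)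
    rw [hpow, h16', ← ENNReal.ofReal_mul (Real.exp_pos _).le, ← Real.exp_add, ← Real.exp_add]
    apply ENNReal.ofReal_le_ofReal
    apply Real.exp_le_exp.2
    linarith
  · refine (mul_le_mul_right hhi _).trans ?_
    rw [hpow, h16, ← ENNReal.ofReal_mul (Real.exp_pos _).le, ← Real.exp_add, ← Real.exp_add]
    apply ENNReal.ofReal_le_ofReal
    apply Real.exp_le_exp.2
    linarith

theorem theorem2 (a : ℕ → ℝ) (ha_pos : ∀ n, 1 ≤ n → 0 < a n)
    (ha_top : Tendsto a atTop atTop)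
    (ha_lower : Tendsto (fun n : ℕ => a n / Real.sqrt ((n : ℝ) * Real.log (n : ℝ))) atTop atTop)
    (ha_upper : Tendsto (fun n : ℕ => a n / (n : ℝ)) atTop (𝓝 0)) :
    SatisfiesDeviationPrinciple (volume.restrict (Set.Ioc (0 : ℝ) 1))
      (fun n x => (Real.log (engelPartialQuotient n x : ℝ) - (n : ℝ)) / a n)
      (fun n => a n ^ 2 / (n : ℝ))
      (fun x => ENNReal.ofReal (x ^ 2 / 2)) := by
  have hv := tendsto_sq_div_atTop ha_lower
  have : IsProbabilityMeasure (volume.restrict (Set.Ioc (0 : ℝ) 1)) := ⟨by simp⟩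
  refine (hasGaussianLogMGF_engelPartialQuotient ha_pos hv ha_upper).satisfiesDeviationPrinciple
    (fun n _ => ?_) (fun n hn => ?_) hv
  · have h := (measurable_of_countable fun k : ℕ => Real.log (k : ℝ)).comp
      (measurable_engelPartialQuotient n)
    exact (h.sub_const _).div_const _
  · have := ha_pos n hn
    have hn' : (0 : ℝ) < n := by exact_mod_cast hn
    positivity
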